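/- Let $n\ge 2$, let $\Omega\subset\mathbb{R}^n$ be a bounded open set, and let $1<p<\infty$. All functions are real valued. Let $L^\infty_+(\Omega)$ be the set of $\sigma\in L^\infty(\Omega)$ such that $\sigma>\varepsilon$ a.e. in $\Omega$ for some $\varepsilon>0$. Let $W^{1,p}_0(\Omega)$ be the closure of $C_c^\infty(\Omega)$ in $W^{1,p}(\Omega)$, let $X=W^{1,p}(\Omega)/W^{1,p}_0(\Omega)$ be the abstract trace space, $X'$ its dual with duality $(\cdot,\cdot)$, and write $u|_{\partial\Omega}\in X$ for the class of $u\in W^{1,p}(\Omega)$. For $\sigma\in L^\infty_+(\Omega)$ and $F\in X$ the Dirichlet problem $$\operatorname{div}(\sigma|\nabla u|^{p-2}\nabla u)=0\ \text{ in }\Omega\ \text{(in the sense of distributions)},\qquad u|_{\partial\Omega}=F,$$ has a unique solution $u\in W^{1,p}(\Omega)$, and the nonlinear Dirichlet-to-Neumann map $\Lambda_\sigma:X\to X'$ is well defined by $$(\Lambda_\sigma F,\,v|_{\partial\Omega})=\int_\Omega \sigma|\nabla u|^{p-2}\nabla u\cdot\nabla v\,dx\qquad\text{for all } v\in W^{1,p}(\Omega).$$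 Moreover, let $\sigma_0,\sigma_1\in L^\infty_+(\Omega)$ and $f\in W^{1,p}(\Omega)$, and let $u_0\in W^{1,p}(\Omega)$ be the solution of $\operatorname{div}(\sigma_0|\nabla u_0|^{p-2}\nabla u_0)=0$ in $\Omega$ with $u_0|_{\partial\Omega}=f|_{\partial\Omega}$. Then, writing $f$ also for $f|_{\partial\Omega}$, $$(p-1)\int_\Omega \frac{\sigma_0}{\sigma_1^{1/(p-1)}}\Big(\sigma_1^{\frac1{p-1}}-\sigma_0^{\frac1{p-1}}\Big)|\nabla u_0|^p\,dx\ \le\ \big((\Lambda_{\sigma_1}-\Lambda_{\sigma_0})f,f\big)\ \le\ \int_\Omega(\sigma_1-\sigma_0)|\nabla u_0|^p\,dx .$$ -/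

import Mathlib

open MeasureTheory

noncomputable section

namespace PCalderon

/-- Euclidean space `ℝⁿ`. -/
abbrev E (n : ℕ) : Type := EuclideanSpace ℝ (Fin n)

instance factOneLeOfReal (p : ℝ) [hp : Fact (1 < p)] : Fact (1 ≤ ENNReal.ofReal p) :=
  ⟨by simpa using ENNReal.ofReal_le_ofReal hp.out.le⟩

/-- The conductivity class `L^∞₊(Ω)`: essentially bounded measurable functions on `Ω` that are
essentially bounded below by a positive constant. -/
def LinftyPos {n : ℕ} (Ω : Set (E n)) : Set (E n → ℝ) :=
  {σ | MemLp σ ⊤ (volume.restrict Ω) ∧ ∃ ε : ℝ, 0 < ε ∧ ∀ᵐ x ∂(volume.restrict Ω), ε < σ x}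

/-- Test functions `C_c^∞(Ω)`, extended by zero to `ℝⁿ`. -/
structure IsTestFunction {n : ℕ} (Ω : Set (E n)) (φ : E n → ℝ) : Prop where
  smooth : ContDiff ℝ (⊤ : ℕ∞) φ
  hasCompactSupport : HasCompactSupport φ
  tsupport_subset : tsupport φ ⊆ Ω

/-- `G` is the weak gradient of `u` in `Ω`: `∫_Ω u ∇φ = - ∫_Ω φ G` for all test functions `φ`. -/
def HasWeakGradient {n : ℕ} (Ω : Set (E n)) (u : E n → ℝ) (G : E n → E n) : Prop :=
  ∀ φ : E n → ℝ, IsTestFunction Ω φ →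
    ∫ x in Ω, u x • gradient φ x = - ∫ x in Ω, φ x • G x

/-- The space `L^p(Ω) × L^p(Ω; ℝⁿ)`. -/
abbrev LpPair {n : ℕ} (Ω : Set (E n)) (p : ℝ) : Type :=
  Lp ℝ (ENNReal.ofReal p) (volume.restrict Ω) × Lp (E n) (ENNReal.ofReal p) (volume.restrict Ω)

section aux

variable {n : ℕ} {Ω : Set (E n)}

theorem IsTestFunction.zero : IsTestFunction Ω (0 : E n → ℝ) :=
  ⟨contDiff_const, HasCompactSupport.zero, by simp [tsupport]⟩

theorem IsTestFunction.add {φ ψ : E n → ℝ} (hφ : IsTestFunction Ω φ) (hψ : IsTestFunction Ω ψ) :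
    IsTestFunction Ω (φ + ψ) :=
  ⟨hφ.smooth.add hψ.smooth, hφ.hasCompactSupport.add hψ.hasCompactSupport,
    (tsupport_add φ ψ).trans (Set.union_subset hφ.tsupport_subset hψ.tsupport_subset)⟩

theorem IsTestFunction.const_smul {φ : E n → ℝ} (c : ℝ) (hφ : IsTestFunction Ω φ) :
    IsTestFunction Ω (c • φ) :=
  ⟨contDiff_const.smul hφ.smooth, hφ.hasCompactSupport.smul_left (f := fun _ => c),
    (tsupport_smul_subset_right (fun _ => c) φ).trans hφ.tsupport_subset⟩

theorem IsTestFunction.differentiable {φ : E n → ℝ} (hφ : IsTestFunction Ω φ) :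
    Differentiable ℝ φ := hφ.smooth.differentiable (by simp)

theorem IsTestFunction.continuous_gradient {φ : E n → ℝ} (hφ : IsTestFunction Ω φ) :
    Continuous (gradient φ) :=
  (InnerProductSpace.toDual ℝ (E n)).symm.continuous.comp
    (hφ.smooth.continuous_fderiv (by simp))

theorem IsTestFunction.hasCompactSupport_gradient {φ : E n → ℝ} (hφ : IsTestFunction Ω φ) :
    HasCompactSupport (gradient φ) :=
  (hφ.hasCompactSupport.fderiv ℝ).comp_left (g := (InnerProductSpace.toDual ℝ (E n)).symm)
    (map_zero _)

theorem gradient_add' {φ ψ : E n → ℝ} (hφ : Differentiable ℝ φ) (hψ : Differentiable ℝ ψ) :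
    gradient (φ + ψ) = gradient φ + gradient ψ := by
  ext1 x
  simp [gradient, fderiv_add (hφ x) (hψ x)]

theorem gradient_const_smul' {φ : E n → ℝ} (c : ℝ) (hφ : Differentiable ℝ φ) :
    gradient (c • φ) = c • gradient φ := by
  ext1 x
  simp [gradient, fderiv_const_smul (hφ x) c]

theorem integrable_smul_gradient {p : ℝ} [Fact (1 < p)]
    (u : Lp ℝ (ENNReal.ofReal p) (volume.restrict Ω)) {φ : E n → ℝ} (hφ : IsTestFunction Ω φ) :
    Integrable (fun x => u x • gradient φ x) (volume.restrict Ω) :=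
  ((Lp.memLp u).locallyIntegrable Fact.out).integrable_smul_right_of_hasCompactSupport
    hφ.continuous_gradient hφ.hasCompactSupport_gradient

theorem integrable_test_smul {p : ℝ} [Fact (1 < p)]
    (G : Lp (E n) (ENNReal.ofReal p) (volume.restrict Ω)) {φ : E n → ℝ}
    (hφ : IsTestFunction Ω φ) :
    Integrable (fun x => φ x • G x) (volume.restrict Ω) :=
  ((Lp.memLp G).locallyIntegrable Fact.out).integrable_smul_left_of_hasCompactSupport
    hφ.smooth.continuous hφ.hasCompactSupport

end aux

/-- The Sobolev space `W^{1,p}(Ω)`: pairs `(u, ∇u)` in `L^p(Ω) × L^p(Ω; ℝⁿ)` whose second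
component is the weak gradient of the first, with the (equivalent) norm
`max (‖u‖_p) (‖∇u‖_p)`. -/
def W1p {n : ℕ} (Ω : Set (E n)) (p : ℝ) [Fact (1 < p)] : Submodule ℝ (LpPair Ω p) where
  carrier := {w | HasWeakGradient Ω w.1 w.2}
  zero_mem' := by
    intro φ _
    have h1 : ∀ᵐ x ∂(volume.restrict Ω),
        ((0 : LpPair Ω p).1 x) • gradient φ x = 0 := by
      filter_upwards [Lp.coeFn_zero ℝ (ENNReal.ofReal p) (volume.restrict Ω)] with x hx
      rw [Prod.fst_zero, hx, Pi.zero_apply, zero_smul]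
    have h2 : ∀ᵐ x ∂(volume.restrict Ω), φ x • ((0 : LpPair Ω p).2 x) = 0 := by
      filter_upwards [Lp.coeFn_zero (E n) (ENNReal.ofReal p) (volume.restrict Ω)] with x hx
      rw [Prod.snd_zero, hx, Pi.zero_apply, smul_zero]
    rw [integral_congr_ae h1, integral_congr_ae h2]
    simp
  add_mem' := by
    intro a b ha hb φ hφ
    have h1 : ∀ᵐ x ∂(volume.restrict Ω), ((a + b).1 x) • gradient φ x
        = a.1 x • gradient φ x + b.1 x • gradient φ x := by
      filter_upwards [Lp.coeFn_add a.1 b.1] with x hx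
      rw [Prod.fst_add, hx, Pi.add_apply, add_smul]
    have h2 : ∀ᵐ x ∂(volume.restrict Ω), φ x • ((a + b).2 x)
        = φ x • a.2 x + φ x • b.2 x := by
      filter_upwards [Lp.coeFn_add a.2 b.2] with x hx
      rw [Prod.snd_add, hx, Pi.add_apply, smul_add]
    rw [integral_congr_ae h1, integral_congr_ae h2,
      integral_add (integrable_smul_gradient a.1 hφ) (integrable_smul_gradient b.1 hφ),
      integral_add (integrable_test_smul a.2 hφ) (integrable_test_smul b.2 hφ),
      ha φ hφ, hb φ hφ, neg_add]
  smul_mem' := by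
    intro c a ha φ hφ
    have h1 : ∀ᵐ x ∂(volume.restrict Ω), ((c • a).1 x) • gradient φ x
        = c • (a.1 x • gradient φ x) := by
      filter_upwards [Lp.coeFn_smul c a.1] with x hx
      rw [Prod.smul_fst, hx, Pi.smul_apply, smul_assoc]
    have h2 : ∀ᵐ x ∂(volume.restrict Ω), φ x • ((c • a).2 x) = c • (φ x • a.2 x) := by
      filter_upwards [Lp.coeFn_smul c a.2] with x hx
      rw [Prod.smul_snd, hx, Pi.smul_apply, smul_comm]
    rw [integral_congr_ae h1, integral_congr_ae h2, integral_smul, integral_smul, ha φ hφ,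
      smul_neg]

section space

variable {n : ℕ} {Ω : Set (E n)} {p : ℝ} [Fact (1 < p)]

/-- The weak gradient `∇u` of `u ∈ W^{1,p}(Ω)`. -/
def weakGrad (u : W1p Ω p) : E n → E n := (u : LpPair Ω p).2

end space

/-- The elements of `W^{1,p}(Ω)` that are given by test functions. -/
def testSubmodule {n : ℕ} (Ω : Set (E n)) (p : ℝ) [Fact (1 < p)] : Submodule ℝ (W1p Ω p) where
  carrier := {w | ∃ φ : E n → ℝ, IsTestFunction Ω φ ∧
    (w : LpPair Ω p).1 =ᵐ[volume.restrict Ω] φ ∧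
    (w : LpPair Ω p).2 =ᵐ[volume.restrict Ω] gradient φ}
  zero_mem' := by
    refine ⟨0, IsTestFunction.zero, Lp.coeFn_zero _ _ _, ?_⟩
    have h : gradient (0 : E n → ℝ) = 0 := by
      ext1 x
      simp [gradient]
    rw [h]
    exact Lp.coeFn_zero _ _ _
  add_mem' := by
    rintro a b ⟨φ, hφ, h1, h2⟩ ⟨ψ, hψ, h3, h4⟩
    refine ⟨φ + ψ, hφ.add hψ, (Lp.coeFn_add _ _).trans (h1.add h3), ?_⟩
    rw [gradient_add' hφ.differentiable hψ.differentiable]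
    exact (Lp.coeFn_add _ _).trans (h2.add h4)
  smul_mem' := by
    rintro c a ⟨φ, hφ, h1, h2⟩
    refine ⟨c • φ, hφ.const_smul c, (Lp.coeFn_smul _ _).trans (h1.const_smul c), ?_⟩
    rw [gradient_const_smul' c hφ.differentiable]
    exact (Lp.coeFn_smul _ _).trans (h2.const_smul c)

/-- `W_0^{1,p}(Ω)`: the closure of the test functions in `W^{1,p}(Ω)`. -/
def W1p0 {n : ℕ} (Ω : Set (E n)) (p : ℝ) [Fact (1 < p)] : Submodule ℝ (W1p Ω p) :=
  (testSubmodule Ω p).topologicalClosure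

/-- The abstract trace space `X = W^{1,p}(Ω) / W_0^{1,p}(Ω)`. -/
abbrev TraceSpace {n : ℕ} (Ω : Set (E n)) (p : ℝ) [Fact (1 < p)] : Type :=
  W1p Ω p ⧸ W1p0 Ω p

section problem

variable {n : ℕ} {Ω : Set (E n)} {p : ℝ} [Fact (1 < p)]

/-- The boundary value `u|_{∂Ω} ∈ X` of `u ∈ W^{1,p}(Ω)`. -/
def trace (u : W1p Ω p) : TraceSpace Ω p := (W1p0 Ω p).mkQ u

/-- The `p`-Laplace flux `σ |∇u|^{p-2} ∇u` of `u`. -/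
def flux (σ : E n → ℝ) (u : W1p Ω p) (x : E n) : E n :=
  (σ x * ‖weakGrad u x‖ ^ (p - 2)) • weakGrad u x

/-- `div(σ |∇u|^{p-2} ∇u) = 0` in `Ω`, in the sense of distributions. -/
def IsWeakSolution (σ : E n → ℝ) (u : W1p Ω p) : Prop :=
  ∀ φ : E n → ℝ, IsTestFunction Ω φ → ∫ x in Ω, inner ℝ (flux σ u x) (gradient φ x) = 0

/-- `u` solves the Dirichlet problem `div(σ |∇u|^{p-2} ∇u) = 0` in `Ω`, `u|_{∂Ω} = F`. -/
def SolvesDirichlet (σ : E n → ℝ) (F : TraceSpace Ω p) (u : W1p Ω p) : Prop :=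
  IsWeakSolution σ u ∧ trace u = F

/-- `ℓ ∈ X'` is the weak normal flux of the solution with boundary value `F`:
`(ℓ, v|_{∂Ω}) = ∫_Ω σ |∇u|^{p-2} ∇u · ∇v` for every `v ∈ W^{1,p}(Ω)`. -/
def IsDNValue (σ : E n → ℝ) (F : TraceSpace Ω p) (ℓ : StrongDual ℝ (TraceSpace Ω p)) : Prop :=
  ∃ u : W1p Ω p, SolvesDirichlet σ F u ∧
    ∀ v : W1p Ω p, ℓ (trace v) = ∫ x in Ω, inner ℝ (flux σ u x) (weakGrad v x)

open Classical in
/-- The nonlinear Dirichlet-to-Neumann map `Λ_σ : X → X'`. -/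
def dnMap (σ : E n → ℝ) (F : TraceSpace Ω p) : StrongDual ℝ (TraceSpace Ω p) :=
  if h : ∃ ℓ, IsDNValue σ F ℓ then h.choose else 0

end problem

end PCalderon

end

/-! The solution with boundary value `f` minimises the `p`-energy `∫ σ |∇u|^p` over
`f + W_0^{1,p}(Ω)`, and the minimum is `(Λ_σ f, f)`. By compactness of the unit sphere of `ℝⁿ × ℝⁿ` and homogeneity,
`|a - b|^p` is at most a small multiple of `|a|^p + |b|^p` plus a large multiple of the gap in the
midpoint convexity of `|·|^p`; hence almost minimising gradients are close to each other, which
yields both existence and uniqueness, the gradients of `W_0^{1,p}(Ω)` being closed in `L^p` by the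
Poincaré inequality. For the upper bound on `((Λ_{σ₁} - Λ_{σ₀}) f, f)`, compare the minimiser for
`σ₁` with `u₀`. The lower bound is the weighted Young inequality
`p s |b|^{p-2} b·a ≤ t |a|^p + (p - 1) s (s / t)^{1/(p-1)} |b|^p` with `s = σ₀`, `t = σ₁`,
`b = ∇u₀`, `a = ∇u₁`, where the left side integrates to `p (Λ_{σ₀} f, f)`.
-/

noncomputable section

namespace PCalderon

section Pointwise

variable {V : Type*} [NormedAddCommGroup V] [InnerProductSpace ℝ V] {p : ℝ}

theorem norm_norm_rpow_smul (hp : 1 < p) (b : V) : ‖‖b‖ ^ (p - 2) • b‖ = ‖b‖ ^ (p - 1) := by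
  rcases eq_or_ne b 0 with rfl | hb
  · rw [smul_zero, norm_zero, Real.zero_rpow (by linarith)]
  · rw [norm_smul, Real.norm_of_nonneg (by positivity), ← Real.rpow_add_one (norm_ne_zero_iff.2 hb)]
    ring_nf

theorem norm_rpow_mul_inner_self (hp : 0 < p) (b : V) :
    ‖b‖ ^ (p - 2) * inner ℝ b b = ‖b‖ ^ p := by
  rw [real_inner_self_eq_norm_sq, ← Real.rpow_two, ← Real.rpow_add' (norm_nonneg b) (by linarith),
    sub_add_cancel]

theorem abs_norm_rpow_mul_inner_le (hp : 1 < p) (a b : V) :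
    |‖b‖ ^ (p - 2) * inner ℝ b a| ≤ ‖a‖ * ‖b‖ ^ (p - 1) := by
  rw [← real_inner_smul_left, ← norm_norm_rpow_smul hp, mul_comm]
  exact abs_real_inner_le_norm _ _

theorem hasDerivAt_norm_add_smul_rpow (hp : 1 < p) (a b : V) (t : ℝ) :
    HasDerivAt (fun t : ℝ => ‖a + t • b‖ ^ p)
      (p * (‖a + t • b‖ ^ (p - 2) * inner ℝ (a + t • b) b)) t := by
  have hline : HasDerivAt (fun t : ℝ => a + t • b) b t := by
    simpa using ((hasDerivAt_id t).smul_const b).const_add a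
  refine ((hasFDerivAt_norm_rpow (a + t • b) hp).comp_hasDerivAt t hline).congr_deriv ?_
  simp only [mul_assoc, smul_apply, innerSL_apply_apply, smul_eq_mul]

theorem abs_norm_add_smul_rpow_mul_inner_le (hp : 1 < p) (a b : V) {t : ℝ} (ht : |t| ≤ 1) :
    |‖a + t • b‖ ^ (p - 2) * inner ℝ (a + t • b) b| ≤ (‖a‖ + ‖b‖) ^ p := by
  have hnorm : ‖a + t • b‖ ≤ ‖a‖ + ‖b‖ := by
    refine (norm_add_le _ _).trans (add_le_add_right ?_ _)
    rw [norm_smul]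
    exact mul_le_of_le_one_left (norm_nonneg _) ht
  calc |‖a + t • b‖ ^ (p - 2) * inner ℝ (a + t • b) b|
      ≤ ‖b‖ * ‖a + t • b‖ ^ (p - 1) := abs_norm_rpow_mul_inner_le hp _ _
    _ ≤ (‖a‖ + ‖b‖) * (‖a‖ + ‖b‖) ^ (p - 1) := by
      gcongr
      exact le_add_of_nonneg_left (norm_nonneg _)
    _ = (‖a‖ + ‖b‖) ^ p := by
      rw [← Real.rpow_one_add' (by positivity) (by linarith), add_sub_cancel]

theorem mul_norm_rpow_mul_inner_le (hp : 1 < p) (a b : V) :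
    p * (‖b‖ ^ (p - 2) * inner ℝ b a) ≤ ‖a‖ ^ p + (p - 1) * ‖b‖ ^ p := by
  have : 0 < p := by linarith
  have hp1 : p - 1 ≠ 0 := by linarith
  have cauchy_schwarz := (le_abs_self _).trans (abs_norm_rpow_mul_inner_le hp a b)
  have young := Real.young_inequality_of_nonneg (norm_nonneg a)
    (show 0 ≤ ‖b‖ ^ (p - 1) by positivity) (Real.HolderConjugate.conjExponent hp)
  rw [← Real.rpow_mul (norm_nonneg b), Real.conjExponent, mul_div_cancel₀ _ hp1] at young
  calc p * (‖b‖ ^ (p - 2) * inner ℝ b a)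
      ≤ p * (‖a‖ ^ p / p + ‖b‖ ^ p / (p / (p - 1))) := by gcongr; exact cauchy_schwarz.trans young
    _ = ‖a‖ ^ p + (p - 1) * ‖b‖ ^ p := by field_simp

theorem mul_weighted_norm_rpow_mul_inner_le (hp : 1 < p) {s t : ℝ} (hs : 0 < s) (ht : 0 < t)
    (a b : V) :
    p * (s * (‖b‖ ^ (p - 2) * inner ℝ b a))
      ≤ t * ‖a‖ ^ p + (p - 1) * (s * (s / t) ^ (1 / (p - 1)) * ‖b‖ ^ p) := by
  -- This is the unweighted inequality for `a` and `r • b`, where `t * r ^ (p - 1) = s`.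
  set r := (s / t) ^ (1 / (p - 1)) with hr
  have hr0 : 0 < r := by positivity
  have hrs : t * r ^ (p - 1) = s := by
    rw [hr, ← Real.rpow_mul (by positivity), one_div_mul_cancel (by linarith), Real.rpow_one,
      mul_div_cancel₀ _ ht.ne']
  have hrp : t * r ^ p = s * r := by
    rw [← hrs, mul_assoc, ← Real.rpow_add_one hr0.ne', sub_add_cancel]
  have hr2 : t * (r ^ (p - 2) * r) = s := by
    rw [← hrs, ← Real.rpow_add_one hr0.ne']
    ring_nf
  have h := mul_le_mul_of_nonneg_left (mul_norm_rpow_mul_inner_le hp a (r • b)) ht.le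
  rw [norm_smul, Real.norm_of_nonneg hr0.le, Real.mul_rpow hr0.le (norm_nonneg b),
    Real.mul_rpow hr0.le (norm_nonneg b), real_inner_smul_left] at h
  calc p * (s * (‖b‖ ^ (p - 2) * inner ℝ b a))
      = t * (p * (r ^ (p - 2) * ‖b‖ ^ (p - 2) * (r * inner ℝ b a))) := by
        linear_combination -(p * (‖b‖ ^ (p - 2) * inner ℝ b a)) * hr2
    _ ≤ t * (‖a‖ ^ p + (p - 1) * (r ^ p * ‖b‖ ^ p)) := h
    _ = t * ‖a‖ ^ p + (p - 1) * (s * r * ‖b‖ ^ p) := by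
        linear_combination (p - 1) * ‖b‖ ^ p * hrp

/-- The defect in the midpoint convexity inequality of `‖·‖ ^ p`. -/
def midpointGap (p : ℝ) (a b : V) : ℝ :=
  (‖a‖ ^ p + ‖b‖ ^ p) / 2 - ‖(1 / 2 : ℝ) • (a + b)‖ ^ p

theorem midpointGap_pos (hp : 1 < p) {a b : V} (hab : a ≠ b) : 0 < midpointGap p a b := by
  have : 0 < p := by linarith
  have hmid : ‖(1 / 2 : ℝ) • (a + b)‖ = ‖a + b‖ / 2 := by
    rw [norm_smul, Real.norm_of_nonneg (by norm_num)]
    ring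
  rw [midpointGap, sub_pos, hmid]
  by_cases h : ‖a‖ = ‖b‖
  · have hlt : ‖a + b‖ < ‖a‖ + ‖b‖ :=
      norm_add_lt_of_not_sameRay fun hray => hab ((sameRay_iff_of_norm_eq h).1 hray)
    calc (‖a + b‖ / 2) ^ p < ‖b‖ ^ p := by gcongr; linarith
      _ = (‖a‖ ^ p + ‖b‖ ^ p) / 2 := by rw [h]; ring
  · calc (‖a + b‖ / 2) ^ p ≤ (1 / 2 * ‖a‖ + 1 / 2 * ‖b‖) ^ p := by
          gcongr
          linarith [norm_add_le a b]
      _ < 1 / 2 * ‖a‖ ^ p + 1 / 2 * ‖b‖ ^ p :=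
          (strictConvexOn_rpow hp).2 (norm_nonneg a) (norm_nonneg b) h
            one_half_pos one_half_pos (add_halves 1)
      _ = (‖a‖ ^ p + ‖b‖ ^ p) / 2 := by ring

theorem midpointGap_self (a : V) : midpointGap p a a = 0 := by
  rw [midpointGap, ← two_smul ℝ a, smul_smul]
  norm_num

theorem midpointGap_smul {r : ℝ} (hr : 0 ≤ r) (a b : V) :
    midpointGap p (r • a) (r • b) = r ^ p * midpointGap p a b := by
  simp only [midpointGap, ← smul_add, smul_comm _ r, norm_smul r, Real.norm_of_nonneg hr,
    Real.mul_rpow hr (norm_nonneg _)]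
  ring

theorem continuous_midpointGap (hp : 0 ≤ p) :
    Continuous fun z : V × V => midpointGap p z.1 z.2 := by
  unfold midpointGap
  fun_prop (disch := simp [hp])

theorem exists_lt_nat_mul_of_isCompact {X : Type*} [TopologicalSpace X] {K : Set X}
    (hK : IsCompact K) {F D : X → ℝ} (hF : Continuous F) (hD : Continuous D) (hD0 : ∀ x, 0 ≤ D x)
    (hFD : ∀ x ∈ K, D x = 0 → F x < 0) : ∃ N : ℕ, ∀ x ∈ K, F x < N * D x := by
  refine hK.elim_directed_cover (fun N : ℕ => {x | F x < N * D x})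
    (fun N => isOpen_lt hF (continuous_const.mul hD)) (fun x hx => Set.mem_iUnion.2 ?_)
    (directed_of_isDirected_le fun M N hMN x hx => ?_)
  · rcases (hD0 x).eq_or_lt with h | h
    · exact ⟨0, by simpa using hFD x hx h.symm⟩
    · obtain ⟨N, hN⟩ := exists_nat_gt (F x / D x)
      exact ⟨N, (div_lt_iff₀ h).1 hN⟩
  · exact (show F x < M * D x from hx).trans_le
      (mul_le_mul_of_nonneg_right (Nat.cast_le.2 hMN) (hD0 x))

theorem exists_le_nat_mul_of_homogeneous {W : Type*} [NormedAddCommGroup W] [NormedSpace ℝ W]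
    [FiniteDimensional ℝ W] (hp : p ≠ 0) {F D : W → ℝ} (hF : Continuous F) (hD : Continuous D)
    (hF_smul : ∀ r : ℝ, 0 ≤ r → ∀ z, F (r • z) = r ^ p * F z)
    (hD_smul : ∀ r : ℝ, 0 ≤ r → ∀ z, D (r • z) = r ^ p * D z) (hD0 : ∀ z, 0 ≤ D z)
    (hFD : ∀ z, z ≠ 0 → D z = 0 → F z < 0) : ∃ N : ℕ, ∀ z, F z ≤ N * D z := by
  have : ProperSpace W := FiniteDimensional.proper_real W
  obtain ⟨N, hN⟩ := exists_lt_nat_mul_of_isCompact (isCompact_sphere (0 : W) 1) hF hD hD0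
    fun z hz => hFD z (ne_zero_of_mem_unit_sphere ⟨z, hz⟩)
  refine ⟨N, fun z => ?_⟩
  rcases eq_or_ne z 0 with rfl | hz
  · have hF_zero := hF_smul 0 le_rfl 0
    have hD_zero := hD_smul 0 le_rfl 0
    rw [smul_zero, Real.zero_rpow hp, zero_mul] at hF_zero hD_zero
    rw [hF_zero, hD_zero, mul_zero]
  · have hz' : 0 < ‖z‖ := norm_pos_iff.2 hz
    have h := (hN (‖z‖⁻¹ • z) (by simp [norm_smul, hz'.ne'])).le
    rw [hF_smul _ (by positivity), hD_smul _ (by positivity), mul_left_comm] at h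
    exact le_of_mul_le_mul_left h (by positivity)

theorem exists_norm_sub_rpow_le [FiniteDimensional ℝ V] (hp : 1 < p) {η : ℝ} (hη : 0 < η) :
    ∃ N : ℕ, ∀ a b : V,
      ‖a - b‖ ^ p ≤ η * (‖a‖ ^ p + ‖b‖ ^ p) + N * midpointGap p a b := by
  have hp0 : 0 < p := by linarith
  let F (z : V × V) : ℝ := ‖z.1 - z.2‖ ^ p - η * (‖z.1‖ ^ p + ‖z.2‖ ^ p)
  have hF_smul (r : ℝ) (hr : 0 ≤ r) (z : V × V) : F (r • z) = r ^ p * F z := by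
    simp only [F, Prod.smul_fst, Prod.smul_snd, ← smul_sub, norm_smul r, Real.norm_of_nonneg hr,
      Real.mul_rpow hr (norm_nonneg _)]
    ring
  have hgap (z : V × V) : 0 ≤ midpointGap p z.1 z.2 := by
    rcases eq_or_ne z.1 z.2 with h | h
    · rw [h, midpointGap_self]
    · exact (midpointGap_pos hp h).le
  have hF_neg (z : V × V) (hz : z ≠ 0) (hz0 : midpointGap p z.1 z.2 = 0) : F z < 0 := by
    have hdiag : z.1 = z.2 := by_contra fun h => (midpointGap_pos hp h).ne' hz0
    have hz2 : 0 < ‖z.2‖ := norm_pos_iff.2 fun h => hz (Prod.ext (hdiag.trans h) h)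
    simp only [F, hdiag, sub_self, norm_zero, Real.zero_rpow hp0.ne', zero_sub, neg_neg_iff_pos]
    positivity
  obtain ⟨N, hN⟩ := exists_le_nat_mul_of_homogeneous hp0.ne' (F := F)
    (by unfold F; fun_prop (disch := simp [hp0.le])) (continuous_midpointGap hp0.le) hF_smul
    (fun r hr z => midpointGap_smul hr z.1 z.2) hgap hF_neg
  exact ⟨N, fun a b => by linarith [hN (a, b)]⟩

end Pointwise

section LpPairing

variable {α : Type*} [MeasurableSpace α] {μ : Measure α} {p : ℝ} [hp : Fact (1 < p)]

instance holderConjugate_ofReal (p : ℝ) [hp : Fact (1 < p)] :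
    (ENNReal.ofReal p).HolderConjugate (ENNReal.ofReal (p / (p - 1))) :=
  (Real.HolderConjugate.conjExponent hp.out).ennrealOfReal

instance factOneLeOfRealConj (p : ℝ) [hp : Fact (1 < p)] :
    Fact (1 ≤ ENNReal.ofReal (p / (p - 1))) :=
  ⟨ENNReal.one_le_ofReal.2 (Real.HolderConjugate.conjExponent hp.out).symm.lt.le⟩

variable {F G H : Type*} [NormedAddCommGroup F] [NormedSpace ℝ F] [NormedAddCommGroup G]
  [NormedSpace ℝ G] [NormedAddCommGroup H] [NormedSpace ℝ H] [CompleteSpace H]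

/-- Integration against a fixed `g` in the conjugate space `L^{p'}`, as a continuous linear map
on `L^p`. -/
def integralPairing (B : G →L[ℝ] F →L[ℝ] H) {g : α → G}
    (hg : MemLp g (ENNReal.ofReal (p / (p - 1))) μ) : Lp F (ENNReal.ofReal p) μ →L[ℝ] H :=
  B.lpPairing μ _ _ (hg.toLp g)

theorem integralPairing_apply (B : G →L[ℝ] F →L[ℝ] H) {g : α → G}
    (hg : MemLp g (ENNReal.ofReal (p / (p - 1))) μ) (f : Lp F (ENNReal.ofReal p) μ) :
    integralPairing B hg f = ∫ x, B (g x) (f x) ∂μ := by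
  rw [integralPairing, ContinuousLinearMap.lpPairing_eq_integral]
  refine integral_congr_ae ?_
  filter_upwards [hg.coeFn_toLp] with x hx
  rw [hx]

end LpPairing

section Energy

variable {α : Type*} [MeasurableSpace α] {μ : Measure α}

/-- A conductivity: an essentially bounded function with a positive essential lower bound. For
Lebesgue measure on `Ω` these are the elements of `LinftyPos Ω`. -/
def IsConductivity (μ : Measure α) (σ : α → ℝ) : Prop :=
  MemLp σ ⊤ μ ∧ ∃ ε : ℝ, 0 < ε ∧ ∀ᵐ x ∂μ, ε < σ x

theorem IsConductivity.exists_ae_mem_Icc {σ : α → ℝ} (hσ : IsConductivity μ σ) :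
    ∃ ε M : ℝ, 0 < ε ∧ ∀ᵐ x ∂μ, σ x ∈ Set.Icc ε M := by
  obtain ⟨hσ_top, ε, hε, hlow⟩ := hσ
  refine ⟨ε, (eLpNormEssSup σ μ).toReal, hε, ?_⟩
  filter_upwards [hlow, ae_le_eLpNormEssSup (f := σ) (μ := μ)] with x hx_low hx_up
  refine ⟨hx_low.le, (Real.le_norm_self _).trans ?_⟩
  rw [← toReal_enorm]
  exact ENNReal.toReal_mono (by simpa using hσ_top.2.ne) hx_up

theorem IsConductivity.ae_pos {σ : α → ℝ} (hσ : IsConductivity μ σ) : ∀ᵐ x ∂μ, 0 < σ x := by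
  obtain ⟨ε, hε, hlow⟩ := hσ.2
  exact hlow.mono fun x hx => hε.trans hx

theorem IsConductivity.memLp_top_comp {σ₀ σ₁ : α → ℝ} (hσ₀ : IsConductivity μ σ₀)
    (hσ₁ : IsConductivity μ σ₁) {g : ℝ × ℝ → ℝ} (hg : Measurable g)
    (hg_cont : ContinuousOn g (Set.Ioi 0 ×ˢ Set.Ioi 0)) :
    MemLp (fun x => g (σ₀ x, σ₁ x)) ⊤ μ := by
  obtain ⟨ε₀, M₀, hε₀, h₀⟩ := hσ₀.exists_ae_mem_Icc
  obtain ⟨ε₁, M₁, hε₁, h₁⟩ := hσ₁.exists_ae_mem_Icc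
  have hsub : Set.Icc ε₀ M₀ ×ˢ Set.Icc ε₁ M₁ ⊆ Set.Ioi (0 : ℝ) ×ˢ Set.Ioi (0 : ℝ) :=
    Set.prod_mono (fun _ hs => hε₀.trans_le hs.1) fun _ hs => hε₁.trans_le hs.1
  obtain ⟨C, hC⟩ := (isCompact_Icc.prod isCompact_Icc).exists_bound_of_continuousOn
    (hg_cont.mono hsub)
  refine memLp_top_of_bound (hg.comp_aemeasurable
    (hσ₀.1.1.aemeasurable.prodMk hσ₁.1.1.aemeasurable)).aestronglyMeasurable C ?_
  filter_upwards [h₀, h₁] with x hx₀ hx₁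
  exact hC _ ⟨hx₀, hx₁⟩

variable {σ σ₀ σ₁ : α → ℝ}

theorem memLp_top_mul_div_rpow (hσ₀ : IsConductivity μ σ₀) (hσ₁ : IsConductivity μ σ₁) (q : ℝ) :
    MemLp (fun x => σ₀ x * (σ₀ x / σ₁ x) ^ q) ⊤ μ := by
  refine hσ₀.memLp_top_comp hσ₁ (g := fun s => s.1 * (s.1 / s.2) ^ q) (by fun_prop) ?_
  have hdiv : ContinuousOn (fun s : ℝ × ℝ => s.1 / s.2) (Set.Ioi 0 ×ˢ Set.Ioi 0) :=
    continuousOn_fst.div continuousOn_snd fun s hs => (Set.mem_Ioi.1 hs.2).ne'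
  exact continuousOn_fst.mul
    (hdiv.rpow_const fun s hs => .inl (div_pos (Set.mem_Ioi.1 hs.1) hs.2).ne')

variable {V : Type*} [NormedAddCommGroup V] {p : ℝ}

/-- The weighted `p`-energy `∫ σ ‖G‖^p` of a field `G ∈ L^p`. -/
def energy (σ : α → ℝ) (G : Lp V (ENNReal.ofReal p) μ) : ℝ := ∫ x, σ x * ‖G x‖ ^ p ∂μ

theorem energy_congr (h : σ₀ =ᵐ[μ] σ₁) (G : Lp V (ENNReal.ofReal p) μ) :
    energy σ₀ G = energy σ₁ G := by
  refine integral_congr_ae ?_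
  filter_upwards [h] with x hx
  rw [hx]

theorem energy_nonneg (hσ : IsConductivity μ σ) (G : Lp V (ENNReal.ofReal p) μ) :
    0 ≤ energy σ G := by
  refine integral_nonneg_of_ae ?_
  filter_upwards [hσ.ae_pos] with x hx
  positivity

section Coercivity

variable [hp : Fact (1 < p)]

theorem integrable_norm_rpow (G : Lp V (ENNReal.ofReal p) μ) :
    Integrable (fun x => ‖G x‖ ^ p) μ := by
  have hp0 : 0 < p := zero_lt_one.trans hp.out
  simpa [ENNReal.toReal_ofReal hp0.le] using
    (Lp.memLp G).integrable_norm_rpow (by simpa using hp0) ENNReal.ofReal_ne_top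

theorem integrable_mul_norm_rpow (hσ : MemLp σ ⊤ μ) (G : Lp V (ENNReal.ofReal p) μ) :
    Integrable (fun x => σ x * ‖G x‖ ^ p) μ :=
  (integrable_norm_rpow G).smul_of_top_right hσ

theorem integrable_norm_add_norm_rpow (G H : Lp V (ENNReal.ofReal p) μ) :
    Integrable (fun x => (‖G x‖ + ‖H x‖) ^ p) μ := by
  have hp0 : 0 < p := zero_lt_one.trans hp.out
  have hsum : MemLp (fun x => ‖G x‖ + ‖H x‖) (ENNReal.ofReal p) μ :=
    (Lp.memLp G).norm.add (Lp.memLp H).norm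
  simpa only [ENNReal.toReal_ofReal hp0.le,
    Real.norm_of_nonneg (add_nonneg (norm_nonneg _) (norm_nonneg _))] using
    hsum.integrable_norm_rpow (by simpa using hp0) ENNReal.ofReal_ne_top

theorem energy_sub (hσ₀ : MemLp σ₀ ⊤ μ) (hσ₁ : MemLp σ₁ ⊤ μ) (G : Lp V (ENNReal.ofReal p) μ) :
    energy (fun x => σ₀ x - σ₁ x) G = energy σ₀ G - energy σ₁ G := by
  simp only [energy, sub_mul]
  exact integral_sub (integrable_mul_norm_rpow hσ₀ G) (integrable_mul_norm_rpow hσ₁ G)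

theorem energy_div_rpow_mul_sub (hσ₀ : IsConductivity μ σ₀) (hσ₁ : IsConductivity μ σ₁) (q : ℝ)
    (G : Lp V (ENNReal.ofReal p) μ) :
    energy (fun x => σ₀ x / σ₁ x ^ q * (σ₁ x ^ q - σ₀ x ^ q)) G
      = energy σ₀ G - energy (fun x => σ₀ x * (σ₀ x / σ₁ x) ^ q) G := by
  rw [← energy_sub hσ₀.1 (memLp_top_mul_div_rpow hσ₀ hσ₁ q)]
  refine energy_congr ?_ G
  filter_upwards [hσ₀.ae_pos, hσ₁.ae_pos] with x hx₀ hx₁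
  rw [Real.div_rpow hx₀.le hx₁.le]
  field_simp

theorem norm_rpow_eq_integral (G : Lp V (ENNReal.ofReal p) μ) : ‖G‖ ^ p = ∫ x, ‖G x‖ ^ p ∂μ := by
  have hp0 : 0 < p := zero_lt_one.trans hp.out
  have h0 : 0 ≤ ∫ x, ‖G x‖ ^ p ∂μ := integral_nonneg fun x => by positivity
  rw [Lp.norm_def, (Lp.memLp G).eLpNorm_eq_integral_rpow_norm (by simpa using hp0)
    ENNReal.ofReal_ne_top, ENNReal.toReal_ofReal hp0.le, ENNReal.toReal_ofReal (by positivity),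
    Real.rpow_inv_rpow h0 hp0.ne']

theorem exists_mul_norm_rpow_le_energy (hσ : IsConductivity μ σ) :
    ∃ ε > 0, ∀ G : Lp V (ENNReal.ofReal p) μ, ε * ‖G‖ ^ p ≤ energy σ G := by
  obtain ⟨hσ_top, ε, hε, hlow⟩ := hσ
  refine ⟨ε, hε, fun G => ?_⟩
  rw [norm_rpow_eq_integral, ← integral_const_mul]
  refine integral_mono_ae ((integrable_norm_rpow G).const_mul ε)
    (integrable_mul_norm_rpow hσ_top G) ?_
  filter_upwards [hlow] with x hx
  gcongr

end Coercivity

variable [InnerProductSpace ℝ V]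

/-- The flux `σ ‖G‖^{p-2} G` of a field `G ∈ L^p`. -/
def pFlux (σ : α → ℝ) (G : Lp V (ENNReal.ofReal p) μ) (x : α) : V :=
  (σ x * ‖G x‖ ^ (p - 2)) • G x

theorem inner_pFlux (σ : α → ℝ) (G : Lp V (ENNReal.ofReal p) μ) (x : α) (b : V) :
    inner ℝ (pFlux σ G x) b = σ x * (‖G x‖ ^ (p - 2) * inner ℝ (G x) b) := by
  rw [pFlux, real_inner_smul_left, mul_assoc]

variable [hp : Fact (1 < p)]

theorem memLp_pFlux (hσ : MemLp σ ⊤ μ) (G : Lp V (ENNReal.ofReal p) μ) :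
    MemLp (pFlux σ G) (ENNReal.ofReal (p / (p - 1))) μ := by
  have hp1 : 0 < p - 1 := sub_pos.2 hp.out
  have hG := Lp.memLp G
  have hpow : MemLp (fun x => ‖G x‖ ^ (p - 1)) (ENNReal.ofReal (p / (p - 1))) μ := by
    simpa only [ENNReal.toReal_ofReal hp1.le, ← ENNReal.ofReal_div_of_pos hp1] using
      hG.norm_rpow_div (ENNReal.ofReal (p - 1))
  have hdual : MemLp (fun x => ‖G x‖ ^ (p - 2) • G x) (ENNReal.ofReal (p / (p - 1))) μ := by
    refine hpow.congr_norm
      ((hG.1.norm.aemeasurable.pow_const _).aestronglyMeasurable.smul hG.1) (.of_forall fun x => ?_)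
    rw [norm_norm_rpow_smul hp.out, Real.norm_of_nonneg (by positivity)]
  exact (hdual.smul hσ).ae_eq (.of_forall fun x => (mul_smul (σ x) _ (G x)).symm)

theorem integrable_inner_pFlux (hσ : MemLp σ ⊤ μ) (G H : Lp V (ENNReal.ofReal p) μ) :
    Integrable (fun x => inner ℝ (pFlux σ G x) (H x)) μ :=
  memLp_one_iff_integrable.1 ((innerSL ℝ).memLp_of_bilin 1 (memLp_pFlux hσ G) (Lp.memLp H))

/-- The functional `H ↦ ∫ σ ‖G‖^{p-2} ⟨G, H⟩` on `L^p`. -/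
def fluxFunctional (hσ : MemLp σ ⊤ μ) (G : Lp V (ENNReal.ofReal p) μ) :
    StrongDual ℝ (Lp V (ENNReal.ofReal p) μ) :=
  integralPairing (innerSL ℝ) (memLp_pFlux hσ G)

theorem fluxFunctional_apply (hσ : MemLp σ ⊤ μ) (G H : Lp V (ENNReal.ofReal p) μ) :
    fluxFunctional hσ G H = ∫ x, inner ℝ (pFlux σ G x) (H x) ∂μ :=
  integralPairing_apply _ _ _

theorem fluxFunctional_self (hσ : MemLp σ ⊤ μ) (G : Lp V (ENNReal.ofReal p) μ) :
    fluxFunctional hσ G G = energy σ G := by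
  rw [fluxFunctional_apply]
  exact integral_congr_ae (.of_forall fun x => by
    simp only [inner_pFlux, norm_rpow_mul_inner_self (zero_lt_one.trans hp.out)])

theorem mul_fluxFunctional_le (hσ₀ : IsConductivity μ σ₀) (hσ₁ : IsConductivity μ σ₁)
    (G H : Lp V (ENNReal.ofReal p) μ) :
    p * fluxFunctional hσ₀.1 G H ≤ energy σ₁ H
      + (p - 1) * energy (fun x => σ₀ x * (σ₀ x / σ₁ x) ^ (1 / (p - 1))) G := by
  have hE₁ := integrable_mul_norm_rpow hσ₁.1 H
  have hE' := (integrable_mul_norm_rpow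
    (memLp_top_mul_div_rpow hσ₀ hσ₁ (1 / (p - 1))) G).const_mul (p - 1)
  rw [fluxFunctional_apply, energy, energy, ← integral_const_mul, ← integral_const_mul,
    ← integral_add hE₁ hE']
  refine integral_mono_ae ((integrable_inner_pFlux hσ₀.1 G H).const_mul p) (hE₁.add hE') ?_
  filter_upwards [hσ₀.ae_pos, hσ₁.ae_pos] with x hx₀ hx₁
  simpa only [inner_pFlux] using mul_weighted_norm_rpow_mul_inner_le hp.out hx₀ hx₁ (H x) (G x)

theorem mul_fluxFunctional_le_self (hσ : IsConductivity μ σ) (G H : Lp V (ENNReal.ofReal p) μ) :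
    p * fluxFunctional hσ.1 G H ≤ energy σ H + (p - 1) * energy σ G := by
  have hone : (fun x => σ x * (σ x / σ x) ^ (1 / (p - 1))) =ᵐ[μ] σ := by
    filter_upwards [hσ.ae_pos] with x hx
    rw [div_self hx.ne', Real.one_rpow, mul_one]
  simpa only [energy_congr hone] using mul_fluxFunctional_le hσ hσ G H

theorem lowerSemicontinuous_energy (hσ : IsConductivity μ σ) :
    LowerSemicontinuous (energy σ : Lp V (ENNReal.ofReal p) μ → ℝ) := by
  intro G c hc
  -- The energy lies above its supporting affine function at `G`.
  have hsupport (H : Lp V (ENNReal.ofReal p) μ) :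
      p * fluxFunctional hσ.1 G H - (p - 1) * energy σ G ≤ energy σ H := by
    linarith [mul_fluxFunctional_le_self hσ G H]
  have hcont : Continuous fun H => p * fluxFunctional hσ.1 G H - (p - 1) * energy σ G := by
    fun_prop
  have hc' : c < p * fluxFunctional hσ.1 G G - (p - 1) * energy σ G := by
    rw [fluxFunctional_self]
    linarith
  exact (hcont.continuousAt.eventually (lt_mem_nhds hc')).mono fun H hH => hH.trans_le (hsupport H)

section FiniteDimensional

variable [FiniteDimensional ℝ V]

theorem exists_energy_sub_le (hσ : IsConductivity μ σ) {η : ℝ} (hη : 0 < η) :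
    ∃ N : ℕ, ∀ G H : Lp V (ENNReal.ofReal p) μ,
      energy σ (G - H) ≤ η * (energy σ G + energy σ H)
        + N * ((energy σ G + energy σ H) / 2 - energy σ ((1 / 2 : ℝ) • (G + H))) := by
  obtain ⟨N, hN⟩ := exists_norm_sub_rpow_le (V := V) hp.out hη
  refine ⟨N, fun G H => ?_⟩
  have hint := integrable_mul_norm_rpow (V := V) (p := p) hσ.1
  have hsum : Integrable (fun x => σ x * ‖G x‖ ^ p + σ x * ‖H x‖ ^ p) μ := (hint G).add (hint H)
  have hmean : Integrable (fun x => (σ x * ‖G x‖ ^ p + σ x * ‖H x‖ ^ p) / 2) μ := hsum.div_const 2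
  have hgap : Integrable (fun x => N * ((σ x * ‖G x‖ ^ p + σ x * ‖H x‖ ^ p) / 2
      - σ x * ‖((1 / 2 : ℝ) • (G + H)) x‖ ^ p)) μ := (hmean.sub (hint _)).const_mul _
  simp only [energy]
  rw [← integral_add (hint G) (hint H), ← integral_const_mul, ← integral_div,
    ← integral_sub hmean (hint _), ← integral_const_mul,
    ← integral_add (hsum.const_mul η) hgap]
  refine integral_mono_ae (hint _) ((hsum.const_mul η).add hgap) ?_
  filter_upwards [hσ.ae_pos, Lp.coeFn_sub G H, Lp.coeFn_smul (1 / 2 : ℝ) (G + H),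
    Lp.coeFn_add G H] with x hx hsub hhalf hadd
  simp only [hsub, hhalf, hadd, Pi.sub_apply, Pi.smul_apply, Pi.add_apply]
  have hpointwise := mul_le_mul_of_nonneg_left (hN (G x) (H x)) hx.le
  rw [midpointGap] at hpointwise
  linarith

theorem exists_norm_sub_lt_of_energy_lt (hσ : IsConductivity μ σ) (m : ℝ) {δ : ℝ} (hδ : 0 < δ) :
    ∃ θ > 0, ∀ G H : Lp V (ENNReal.ofReal p) μ, m ≤ energy σ (midpoint ℝ G H) →
      energy σ G < m + θ → energy σ H < m + θ → ‖G - H‖ < δ := by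
  obtain ⟨ε, hε, hcoercive⟩ := exists_mul_norm_rpow_le_energy (V := V) (p := p) hσ
  set τ := ε * δ ^ p
  have hτ0 : 0 < τ := by positivity
  obtain ⟨N, hN⟩ := exists_energy_sub_le (V := V) (p := p) hσ
    (show 0 < τ / (4 * (|m| + 1)) by positivity)
  refine ⟨min 1 (τ / (2 * (N + 1))), by positivity, fun G H hmid hG hH => ?_⟩
  rw [midpoint_eq_smul_add, invOf_eq_inv, ← one_div] at hmid
  have hsum : energy σ G + energy σ H < 2 * (|m| + 1) := by
    linarith [le_abs_self m, min_le_left 1 (τ / (2 * ((N : ℝ) + 1)))]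
  have hgap : (energy σ G + energy σ H) / 2 - energy σ ((1 / 2 : ℝ) • (G + H))
      ≤ τ / (2 * (N + 1)) := by
    linarith [min_le_right 1 (τ / (2 * ((N : ℝ) + 1)))]
  have hsmall : energy σ (G - H) < τ := calc
    energy σ (G - H) ≤ τ / (4 * (|m| + 1)) * (energy σ G + energy σ H)
        + N * ((energy σ G + energy σ H) / 2 - energy σ ((1 / 2 : ℝ) • (G + H))) := hN G H
    _ < τ / (4 * (|m| + 1)) * (2 * (|m| + 1)) + N * (τ / (2 * (N + 1))) :=
        add_lt_add_of_lt_of_le (by gcongr) (by gcongr)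
    _ ≤ τ / (4 * (|m| + 1)) * (2 * (|m| + 1)) + (N + 1) * (τ / (2 * (N + 1))) := by
        gcongr; linarith
    _ = τ := by field_simp; norm_num
  have hpow : ‖G - H‖ ^ p < δ ^ p := lt_of_mul_lt_mul_left ((hcoercive _).trans_lt hsmall) hε.le
  exact (Real.rpow_lt_rpow_iff (norm_nonneg _) hδ.le (zero_lt_one.trans hp.out)).1 hpow

end FiniteDimensional

theorem hasDerivAt_energy_add_smul (hσ : MemLp σ ⊤ μ) (G H : Lp V (ENNReal.ofReal p) μ) :
    HasDerivAt (fun t : ℝ => energy σ (G + t • H)) (p * fluxFunctional hσ G H) 0 := by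
  have hp0 : 0 < p := zero_lt_one.trans hp.out
  let φ (t : ℝ) (x : α) : ℝ := σ x * ‖G x + t • H x‖ ^ p
  let φ' (t : ℝ) (x : α) : ℝ :=
    σ x * (p * (‖G x + t • H x‖ ^ (p - 2) * inner ℝ (G x + t • H x) (H x)))
  have hφ_eq (t : ℝ) : (fun x => σ x * ‖(G + t • H) x‖ ^ p) =ᵐ[μ] φ t := by
    filter_upwards [Lp.coeFn_add G (t • H), Lp.coeFn_smul t H] with x hadd hsmul
    simp only [φ, hadd, hsmul, Pi.add_apply, Pi.smul_apply]
  have hφ_int (t : ℝ) : Integrable (φ t) μ := (integrable_mul_norm_rpow hσ _).congr (hφ_eq t)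
  have hφ'_zero : (fun x => p * inner ℝ (pFlux σ G x) (H x)) = φ' 0 := by
    funext x
    simp only [φ', inner_pFlux, zero_smul, add_zero]
    ring
  have hφ'_le (x : α) (t : ℝ) (ht : t ∈ Metric.ball (0 : ℝ) 1) :
      ‖φ' t x‖ ≤ |σ x| * (p * (‖G x‖ + ‖H x‖) ^ p) := by
    rw [Real.norm_eq_abs, abs_mul, abs_mul, abs_of_pos hp0]
    gcongr
    exact abs_norm_add_smul_rpow_mul_inner_le hp.out (G x) (H x) (mem_ball_zero_iff.1 ht).le
  have key := (hasDerivAt_integral_of_dominated_loc_of_deriv_le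
    (Metric.ball_mem_nhds (0 : ℝ) one_pos) (.of_forall fun t => (hφ_int t).1) (hφ_int 0)
    (hφ'_zero ▸ ((integrable_inner_pFlux hσ G H).const_mul p).1) (.of_forall hφ'_le)
    (((integrable_norm_add_norm_rpow G H).const_mul p).smul_of_top_right hσ.norm)
    (.of_forall fun x t _ =>
      (hasDerivAt_norm_add_smul_rpow hp.out (G x) (H x) t).const_mul (σ x))).2
  rw [fluxFunctional_apply, ← integral_const_mul, hφ'_zero]
  exact key.congr_of_eventuallyEq (.of_forall fun t => integral_congr_ae (hφ_eq t))

theorem isMinOn_energy_iff (hσ : IsConductivity μ σ) {K : Submodule ℝ (Lp V (ENNReal.ofReal p) μ)}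
    {G₀ G : Lp V (ENNReal.ofReal p) μ} (hG : G - G₀ ∈ K) :
    IsMinOn (energy σ) {G' | G' - G₀ ∈ K} G ↔ ∀ H ∈ K, fluxFunctional hσ.1 G H = 0 := by
  refine ⟨fun hmin H hH => ?_, fun hzero G' hG' => ?_⟩
  · have hlocal : IsLocalMin (fun t : ℝ => energy σ (G + t • H)) 0 := by
      refine .of_forall fun t => ?_
      have hmem : G + t • H - G₀ ∈ K := by
        rw [add_sub_right_comm]
        exact K.add_mem hG (K.smul_mem t hH)
      simpa using hmin hmem
    have hderiv := hlocal.hasDerivAt_eq_zero (hasDerivAt_energy_add_smul hσ.1 G H)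
    exact (mul_eq_zero.1 hderiv).resolve_left (zero_lt_one.trans hp.out).ne'
  · have hmem : G' - G ∈ K := by
      rw [← sub_sub_sub_cancel_right G' G G₀]
      exact K.sub_mem hG' hG
    have hpair : fluxFunctional hσ.1 G G' = energy σ G := by
      rw [← fluxFunctional_self hσ.1, ← sub_eq_zero, ← map_sub]
      exact hzero _ hmem
    have hle := mul_fluxFunctional_le_self hσ G G'
    rw [hpair] at hle
    change energy σ G ≤ energy σ G'
    linarith

theorem exists_isMinOn_of_near_minimizers_close {X : Type*} [PseudoMetricSpace X] [CompleteSpace X]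
    {S : Set X} (hS : IsClosed S) (hne : S.Nonempty) {f : X → ℝ} (hf : LowerSemicontinuous f)
    (hbdd : BddBelow (f '' S))
    (hclose : ∀ δ > 0, ∃ θ > 0, ∀ x ∈ S, ∀ y ∈ S,
      f x < sInf (f '' S) + θ → f y < sInf (f '' S) + θ → dist x y < δ) :
    ∃ x ∈ S, IsMinOn f S x := by
  obtain ⟨v, -, hv, hvS⟩ := exists_seq_tendsto_sInf (hne.image f) hbdd
  choose x hxS hxv using hvS
  have hcauchy : CauchySeq x := by
    refine Metric.cauchySeq_iff.2 fun δ hδ => ?_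
    obtain ⟨θ, hθ, h⟩ := hclose δ hδ
    obtain ⟨N, hN⟩ := Filter.eventually_atTop.1 (hv.eventually_lt_const (lt_add_of_pos_right _ hθ))
    exact ⟨N, fun k hk l hl => h _ (hxS k) _ (hxS l)
      ((hxv k).trans_lt (hN k hk)) ((hxv l).trans_lt (hN l hl))⟩
  obtain ⟨z, hz⟩ := cauchySeq_tendsto_of_complete hcauchy
  have hfz : f z ≤ sInf (f '' S) := by
    refine le_of_forall_lt fun c hc => ?_
    obtain ⟨c', hcc', hc'⟩ := exists_between hc
    refine hcc'.trans_le (ge_of_tendsto hv ?_)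
    filter_upwards [hz.eventually (hf z c' hc')] with k hk
    exact (hxv k ▸ hk).le
  exact ⟨z, hS.mem_of_tendsto hz (.of_forall hxS), fun y hy =>
    hfz.trans (csInf_le hbdd (Set.mem_image_of_mem f hy))⟩

section WellPosedness

variable [FiniteDimensional ℝ V] {S : Set (Lp V (ENNReal.ofReal p) μ)}

theorem exists_isMinOn_energy (hσ : IsConductivity μ σ) (hS : IsClosed S) (hconv : Convex ℝ S)
    (hne : S.Nonempty) : ∃ G ∈ S, IsMinOn (energy σ) S G := by
  have : CompleteSpace V := FiniteDimensional.complete ℝ V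
  have hbdd : BddBelow (energy σ '' S) := ⟨0, by rintro _ ⟨G, -, rfl⟩; exact energy_nonneg hσ G⟩
  refine exists_isMinOn_of_near_minimizers_close hS hne (lowerSemicontinuous_energy hσ) hbdd
    fun δ hδ => ?_
  obtain ⟨θ, hθ, h⟩ :=
    exists_norm_sub_lt_of_energy_lt (V := V) (p := p) hσ (sInf (energy σ '' S)) hδ
  refine ⟨θ, hθ, fun G hG H hH hGθ hHθ => ?_⟩
  rw [dist_eq_norm]
  exact h G H (csInf_le hbdd ⟨_, hconv.midpoint_mem hG hH, rfl⟩) hGθ hHθ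

theorem isMinOn_energy_unique (hσ : IsConductivity μ σ) (hconv : Convex ℝ S)
    {G H : Lp V (ENNReal.ofReal p) μ} (hGS : G ∈ S) (hHS : H ∈ S) (hG : IsMinOn (energy σ) S G)
    (hH : IsMinOn (energy σ) S H) : G = H := by
  rw [← sub_eq_zero, ← norm_le_zero_iff]
  refine le_of_forall_pos_lt_add fun δ hδ => ?_
  obtain ⟨θ, hθ, h⟩ := exists_norm_sub_lt_of_energy_lt (V := V) (p := p) hσ (energy σ G) hδ
  rw [zero_add]
  have hHG : energy σ H ≤ energy σ G := hH hGS
  exact h G H (hG (hconv.midpoint_mem hGS hHS)) (by linarith) (by linarith)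

theorem existsUnique_fluxFunctional_eq_zero (hσ : IsConductivity μ σ)
    {K : Submodule ℝ (Lp V (ENNReal.ofReal p) μ)}
    (hK : IsClosed (K : Set (Lp V (ENNReal.ofReal p) μ))) (G₀ : Lp V (ENNReal.ofReal p) μ) :
    ∃! G, G - G₀ ∈ K ∧ ∀ H ∈ K, fluxFunctional hσ.1 G H = 0 := by
  have hclosed : IsClosed {G | G - G₀ ∈ K} := hK.preimage (continuous_id.sub continuous_const)
  have hconv : Convex ℝ {G | G - G₀ ∈ K} := by
    simp only [sub_eq_add_neg]
    exact K.convex.translate_preimage_left (-G₀)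
  obtain ⟨G, hG, hmin⟩ := exists_isMinOn_energy hσ hclosed hconv ⟨G₀, by simp⟩
  refine ⟨G, ⟨hG, (isMinOn_energy_iff hσ hG).1 hmin⟩, fun G' ⟨hG', hzero⟩ => ?_⟩
  exact isMinOn_energy_unique hσ hconv hG' hG ((isMinOn_energy_iff hσ hG').2 hzero) hmin

end WellPosedness

end Energy

section Poincare

variable {W V : Type*} [NormedAddCommGroup W] [NormedSpace ℝ W] [FiniteDimensional ℝ W]
  [MeasurableSpace W] [BorelSpace W] {μ : Measure W} [μ.IsAddHaarMeasure]
  [NormedAddCommGroup V] [InnerProductSpace ℝ V] {p : ℝ} {u : W → V}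

theorem integral_norm_rpow_le_integral_norm_smul_fderiv_rpow (hp : 1 < p) (hu : ContDiff ℝ 1 u)
    (hu_supp : HasCompactSupport u) (L : StrongDual ℝ W) {v : W} (hLv : L v = 1) :
    ∫ x, ‖u x‖ ^ p ∂μ ≤ ∫ x, ‖-(p * L x) • fderiv ℝ u x v‖ ^ p ∂μ := by
  have hp0 : 0 < p := by linarith
  let a (x : W) : V := -(p * L x) • fderiv ℝ u x v
  have ha_cont : Continuous a := (continuous_const.mul L.continuous).neg.smul
    ((hu.continuous_fderiv one_ne_zero).clm_apply continuous_const)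
  have hpow : ContDiff ℝ 1 fun x => ‖u x‖ ^ p := hu.norm_rpow hp
  have hpow_supp : HasCompactSupport fun x => ‖u x‖ ^ p :=
    hu_supp.comp_left (g := fun b => ‖b‖ ^ p) (by simp [hp0.ne'])
  have hpow_int : Integrable (fun x => ‖u x‖ ^ p) μ :=
    hpow.continuous.integrable_of_hasCompactSupport hpow_supp
  have ha_int : Integrable (fun x => ‖a x‖ ^ p) μ :=
    (ha_cont.norm.rpow_const fun _ => .inr hp0.le).integrable_of_hasCompactSupport
      ((hu_supp.fderiv_apply ℝ v).smul_left.comp_left (g := fun b => ‖b‖ ^ p) (by simp [hp0.ne']))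
  have hderiv (x : W) : -(fderiv ℝ (fun y => ‖u y‖ ^ p) x v * L x)
      = ‖u x‖ ^ (p - 2) * inner ℝ (u x) (a x) := by
    simp only [(hu.differentiable one_ne_zero).fderiv_norm_rpow hp, a, smul_apply,
      innerSL_apply_apply, smul_eq_mul, ContinuousLinearMap.comp_apply, real_inner_smul_right]
    ring
  have hderiv_int : Integrable (fun x => fderiv ℝ (fun y => ‖u y‖ ^ p) x v * L x) μ :=
    (((hpow.continuous_fderiv one_ne_zero).clm_apply continuous_const).mul
      L.continuous).integrable_of_hasCompactSupport (hpow_supp.fderiv_apply ℝ v).mul_right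
  -- Integrate by parts against `L`, whose derivative along `v` is `1`.
  have hparts : ∫ x, ‖u x‖ ^ p ∂μ = ∫ x, ‖u x‖ ^ (p - 2) * inner ℝ (u x) (a x) ∂μ := by
    have h := integral_mul_fderiv_eq_neg_fderiv_mul_of_integrable (g := L) hderiv_int
      (by simpa only [L.fderiv, hLv, mul_one] using hpow_int)
      ((hpow.continuous.mul L.continuous).integrable_of_hasCompactSupport hpow_supp.mul_right)
      (fun x _ => hpow.differentiable one_ne_zero x) fun x _ => L.differentiableAt
    simpa only [L.fderiv, hLv, mul_one, ← integral_neg, hderiv] using h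
  have hyoung : p * ∫ x, ‖u x‖ ^ p ∂μ ≤ ∫ x, ‖a x‖ ^ p ∂μ + (p - 1) * ∫ x, ‖u x‖ ^ p ∂μ := by
    nth_rw 1 [hparts]
    rw [← integral_const_mul, ← integral_const_mul,
      ← integral_add ha_int (hpow_int.const_mul (p - 1))]
    exact integral_mono ((hderiv_int.neg.congr (.of_forall hderiv)).const_mul p)
      (ha_int.add (hpow_int.const_mul _)) fun x => mul_norm_rpow_mul_inner_le hp (a x) (u x)
  linarith

theorem integral_norm_rpow_le_mul_integral_norm_fderiv_rpow (hp : 1 < p) (hu : ContDiff ℝ 1 u)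
    (hu_supp : HasCompactSupport u) (L : StrongDual ℝ W) {v : W} (hLv : L v = 1) {R : ℝ}
    (hR0 : 0 ≤ R) (hR : ∀ x ∈ tsupport u, |L x| ≤ R) :
    ∫ x, ‖u x‖ ^ p ∂μ ≤ (p * R * ‖v‖) ^ p * ∫ x, ‖fderiv ℝ u x‖ ^ p ∂μ := by
  have hp0 : 0 < p := by linarith
  have hint : Integrable (fun x => ‖fderiv ℝ u x‖ ^ p) μ :=
    ((hu.continuous_fderiv one_ne_zero).norm.rpow_const
      fun _ => .inr hp0.le).integrable_of_hasCompactSupport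
      ((hu_supp.fderiv ℝ).comp_left (g := fun T => ‖T‖ ^ p) (by simp [hp0.ne']))
  have hle (x : W) : ‖-(p * L x) • fderiv ℝ u x v‖ ≤ p * R * ‖v‖ * ‖fderiv ℝ u x‖ := by
    by_cases hx : x ∈ tsupport u
    · rw [norm_smul, norm_neg, norm_mul, Real.norm_of_nonneg hp0.le, Real.norm_eq_abs]
      calc p * |L x| * ‖fderiv ℝ u x v‖ ≤ p * R * (‖fderiv ℝ u x‖ * ‖v‖) := by
            gcongr
            exacts [hR x hx, (fderiv ℝ u x).le_opNorm v]
        _ = p * R * ‖v‖ * ‖fderiv ℝ u x‖ := by ring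
    · simp [fderiv_of_notMem_tsupport ℝ hx]
  refine (integral_norm_rpow_le_integral_norm_smul_fderiv_rpow hp hu hu_supp L hLv).trans ?_
  rw [← integral_const_mul]
  refine integral_mono_of_nonneg (.of_forall fun x => by positivity) (hint.const_mul _)
    (.of_forall fun x => ?_)
  dsimp only
  rw [← Real.mul_rpow (by positivity) (norm_nonneg _)]
  gcongr
  exact hle x

end Poincare

section Sobolev

variable {n : ℕ} {Ω : Set (E n)}

theorem IsTestFunction.memLp {φ : E n → ℝ} (hφ : IsTestFunction Ω φ) (q : ENNReal) :
    MemLp φ q (volume.restrict Ω) :=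
  (hφ.smooth.continuous.memLp_of_hasCompactSupport hφ.hasCompactSupport).restrict _

theorem IsTestFunction.memLp_gradient {φ : E n → ℝ} (hφ : IsTestFunction Ω φ) (q : ENNReal) :
    MemLp (gradient φ) q (volume.restrict Ω) :=
  (hφ.continuous_gradient.memLp_of_hasCompactSupport hφ.hasCompactSupport_gradient).restrict _

theorem IsTestFunction.eq_zero_of_notMem {φ : E n → ℝ} (hφ : IsTestFunction Ω φ) {x : E n}
    (hx : x ∉ Ω) : φ x = 0 :=
  image_eq_zero_of_notMem_tsupport fun h => hx (hφ.tsupport_subset h)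

theorem IsTestFunction.gradient_eq_zero_of_notMem {φ : E n → ℝ} (hφ : IsTestFunction Ω φ)
    {x : E n} (hx : x ∉ Ω) : gradient φ x = 0 := by
  rw [gradient, fderiv_of_notMem_tsupport ℝ fun h => hx (hφ.tsupport_subset h), map_zero]

theorem IsTestFunction.hasWeakGradient {φ : E n → ℝ} (hφ : IsTestFunction Ω φ) :
    HasWeakGradient Ω φ (gradient φ) := by
  intro ψ hψ
  have hint {f g : E n → ℝ} (hf : IsTestFunction Ω f) (hg : IsTestFunction Ω g) :
      Integrable fun x => f x • gradient g x :=
    (hf.smooth.continuous.smul hg.continuous_gradient).integrable_of_hasCompactSupport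
      hf.hasCompactSupport.smul_right
  have hint_apply {f g : E n → ℝ} (hf : IsTestFunction Ω f) (hg : IsTestFunction Ω g) (v : E n) :
      Integrable fun x => f x * fderiv ℝ g x v := by
    simpa only [inner_smul_right, inner_gradient_right, conj_trivial]
      using (hint hf hg).const_inner (𝕜 := ℝ) v
  rw [setIntegral_eq_integral_of_forall_compl_eq_zero
      fun x hx => by rw [hψ.gradient_eq_zero_of_notMem hx, smul_zero],
    setIntegral_eq_integral_of_forall_compl_eq_zero
      fun x hx => by rw [hφ.gradient_eq_zero_of_notMem hx, smul_zero]]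
  refine ext_inner_left ℝ fun v => ?_
  rw [inner_neg_right, ← integral_inner (hint hφ hψ), ← integral_inner (hint hψ hφ)]
  simp only [inner_smul_right, inner_gradient_right, conj_trivial, mul_comm (ψ _)]
  exact integral_mul_fderiv_eq_neg_fderiv_mul_of_integrable
    (by simpa only [mul_comm] using hint_apply hψ hφ v) (hint_apply hφ hψ v)
    ((hφ.smooth.continuous.mul hψ.smooth.continuous).integrable_of_hasCompactSupport
      hφ.hasCompactSupport.mul_right)
    (fun x _ => hφ.differentiable x) fun x _ => hψ.differentiable x

theorem IsTestFunction.setIntegral_norm_rpow_le {p : ℝ} (hn : n ≠ 0) (hp : 1 < p) {φ : E n → ℝ}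
    (hφ : IsTestFunction Ω φ) {R : ℝ} (hR0 : 0 ≤ R) (hR : ∀ x ∈ Ω, ‖x‖ ≤ R) :
    ∫ x in Ω, ‖φ x‖ ^ p ≤ (p * R) ^ p * ∫ x in Ω, ‖gradient φ x‖ ^ p := by
  have hp0 : p ≠ 0 := by linarith
  let e : E n := EuclideanSpace.single ⟨0, Nat.pos_of_ne_zero hn⟩ 1
  have he : ‖e‖ = 1 := by simp [e]
  have h := integral_norm_rpow_le_mul_integral_norm_fderiv_rpow (μ := volume) hp
    (hφ.smooth.of_le (by exact_mod_cast le_top)) hφ.hasCompactSupport (innerSL ℝ e) (v := e)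
    (by simp [he]) hR0 fun x hx => (abs_real_inner_le_norm e x).trans
      (by simpa only [he, one_mul] using hR x (hφ.tsupport_subset hx))
  rw [setIntegral_eq_integral_of_forall_compl_eq_zero fun x hx => by
      rw [hφ.eq_zero_of_notMem hx, norm_zero, Real.zero_rpow hp0],
    setIntegral_eq_integral_of_forall_compl_eq_zero fun x hx => by
      rw [hφ.gradient_eq_zero_of_notMem hx, norm_zero, Real.zero_rpow hp0]]
  simpa only [he, mul_one, gradient, LinearIsometryEquiv.norm_map] using h

variable {p : ℝ} [hp : Fact (1 < p)]

theorem isClosed_W1p : IsClosed (W1p Ω p : Set (LpPair Ω p)) := by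
  have h : (W1p Ω p : Set (LpPair Ω p)) = ⋂ φ : E n → ℝ, ⋂ hφ : IsTestFunction Ω φ,
      {w | integralPairing (ContinuousLinearMap.lsmul ℝ ℝ).flip (hφ.memLp_gradient _) w.1
        = -integralPairing (ContinuousLinearMap.lsmul ℝ ℝ) (hφ.memLp _) w.2} := by
    ext w
    simp only [Set.mem_iInter, Set.mem_ofPred_eq, integralPairing_apply]
    rfl
  rw [h]
  exact isClosed_iInter fun φ => isClosed_iInter fun hφ => isClosed_eq (by fun_prop) (by fun_prop)

instance completeSpace_W1p : CompleteSpace (W1p Ω p) :=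
  isClosed_W1p.completeSpace_coe

theorem IsTestFunction.exists_mem_testSubmodule {φ : E n → ℝ} (hφ : IsTestFunction Ω φ) :
    ∃ w ∈ testSubmodule Ω p, weakGrad w =ᵐ[volume.restrict Ω] gradient φ := by
  have hval := (hφ.memLp (ENNReal.ofReal p)).coeFn_toLp
  have hgrad := (hφ.memLp_gradient (ENNReal.ofReal p)).coeFn_toLp
  refine ⟨⟨((hφ.memLp _).toLp φ, (hφ.memLp_gradient _).toLp _), fun ψ hψ => ?_⟩,
    ⟨φ, hφ, hval, hgrad⟩, hgrad⟩
  rw [integral_congr_ae (hval.mono fun x hx => congrArg (· • gradient ψ x) hx),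
    integral_congr_ae (hgrad.mono fun x hx => congrArg (ψ x • ·) hx)]
  exact hφ.hasWeakGradient ψ hψ

/-- The Poincaré inequality on `W_0^{1,p}(Ω)`. -/
def PoincareInequality (Ω : Set (E n)) (p : ℝ) [Fact (1 < p)] : Prop :=
  ∃ C : NNReal, ∀ w ∈ W1p0 Ω p, ‖(w : LpPair Ω p).1‖ ≤ C * ‖(w : LpPair Ω p).2‖

theorem poincareInequality_of_isBounded (hn : n ≠ 0) (hΩ : Bornology.IsBounded Ω) :
    PoincareInequality Ω p := by
  have hp0 : 0 < p := zero_lt_one.trans hp.out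
  obtain ⟨R, hR0, hR⟩ := hΩ.exists_pos_norm_le
  refine ⟨⟨p * R, by positivity⟩, fun w hw => ?_⟩
  have hclosed : IsClosed {w : W1p Ω p |
      ‖(w : LpPair Ω p).1‖ ≤ p * R * ‖(w : LpPair Ω p).2‖} :=
    isClosed_le (by fun_prop) (by fun_prop)
  refine closure_minimal ?_ hclosed hw
  rintro w ⟨φ, hφ, hval, hgrad⟩
  refine (Real.rpow_le_rpow_iff (norm_nonneg _) (by positivity) hp0).1 ?_
  rw [Real.mul_rpow (by positivity) (norm_nonneg _), norm_rpow_eq_integral, norm_rpow_eq_integral,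
    integral_congr_ae (hval.mono fun x hx => congrArg (‖·‖ ^ p) hx),
    integral_congr_ae (hgrad.mono fun x hx => congrArg (‖·‖ ^ p) hx)]
  exact hφ.setIntegral_norm_rpow_le hn hp.out hR0.le hR

end Sobolev

section Dirichlet

variable {n : ℕ} {Ω : Set (E n)} {p : ℝ} [hp : Fact (1 < p)]

/-- The weak gradient `u ↦ ∇u`, as a continuous linear map from `W^{1,p}(Ω)` to `L^p(Ω; ℝⁿ)`. -/
def weakGradL (Ω : Set (E n)) (p : ℝ) [Fact (1 < p)] :
    W1p Ω p →L[ℝ] Lp (E n) (ENNReal.ofReal p) (volume.restrict Ω) :=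
  (ContinuousLinearMap.snd ℝ _ _).comp (W1p Ω p).subtypeL

theorem trace_eq_trace_iff {u v : W1p Ω p} : trace u = trace v ↔ u - v ∈ W1p0 Ω p :=
  Submodule.Quotient.eq _

theorem PoincareInequality.exists_norm_le (hΩ : PoincareInequality Ω p) :
    ∃ C : NNReal, ∀ w ∈ W1p0 Ω p, ‖w‖ ≤ C * ‖weakGradL Ω p w‖ := by
  obtain ⟨C, hC⟩ := hΩ
  refine ⟨max C 1, fun w hw => max_le ((hC w hw).trans ?_) ?_⟩
  · gcongr
    exacts [le_max_left C 1, le_rfl]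
  · exact le_mul_of_one_le_left (norm_nonneg _) (by simp)

theorem isClosed_map_of_forall_norm_le {X Y : Type*} [NormedAddCommGroup X] [NormedSpace ℝ X]
    [CompleteSpace X] [NormedAddCommGroup Y] [NormedSpace ℝ Y] (T : X →L[ℝ] Y) {K : Submodule ℝ X}
    (hK : IsClosed (K : Set X)) {C : NNReal} (hC : ∀ x ∈ K, ‖x‖ ≤ C * ‖T x‖) :
    IsClosed (K.map T.toLinearMap : Set Y) := by
  have : CompleteSpace K := hK.completeSpace_coe
  have hT : AntilipschitzWith C (T.comp K.subtypeL) :=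
    (T.comp K.subtypeL).antilipschitz_of_bound fun x => hC x x.2
  rw [Submodule.map_coe, Set.image_eq_range]
  exact hT.isClosed_range (T.comp K.subtypeL).uniformContinuous

/-- The space `∇ W_0^{1,p}(Ω)` of gradients of functions with zero boundary values. -/
def gradW1p0 (Ω : Set (E n)) (p : ℝ) [Fact (1 < p)] :
    Submodule ℝ (Lp (E n) (ENNReal.ofReal p) (volume.restrict Ω)) :=
  (W1p0 Ω p).map (weakGradL Ω p).toLinearMap

theorem PoincareInequality.isClosed_gradW1p0 (hΩ : PoincareInequality Ω p) :
    IsClosed (gradW1p0 Ω p : Set (Lp (E n) (ENNReal.ofReal p) (volume.restrict Ω))) := by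
  obtain ⟨C, hC⟩ := hΩ.exists_norm_le
  exact isClosed_map_of_forall_norm_le (weakGradL Ω p) isClosed_closure hC

theorem PoincareInequality.eq_of_weakGradL_eq (hΩ : PoincareInequality Ω p) {u v : W1p Ω p}
    (htrace : trace u = trace v) (hgrad : weakGradL Ω p u = weakGradL Ω p v) : u = v := by
  obtain ⟨C, hC⟩ := hΩ.exists_norm_le
  have h := hC (u - v) (trace_eq_trace_iff.1 htrace)
  rw [map_sub, hgrad, sub_self, norm_zero, mul_zero] at h
  exact sub_eq_zero.1 (norm_le_zero_iff.1 h)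

variable {σ σ₀ σ₁ : E n → ℝ}

theorem isWeakSolution_iff (hσ : MemLp σ ⊤ (volume.restrict Ω)) {u : W1p Ω p} :
    IsWeakSolution σ u ↔
      ∀ w ∈ W1p0 Ω p, fluxFunctional hσ (weakGradL Ω p u) (weakGradL Ω p w) = 0 := by
  have happly {w : W1p Ω p} {φ : E n → ℝ} (h : weakGrad w =ᵐ[volume.restrict Ω] gradient φ) :
      fluxFunctional hσ (weakGradL Ω p u) (weakGradL Ω p w)
        = ∫ x in Ω, inner ℝ (flux σ u x) (gradient φ x) := by
    rw [fluxFunctional_apply]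
    exact integral_congr_ae (h.mono fun x hx => congrArg (inner ℝ (flux σ u x)) hx)
  refine ⟨fun hu w hw => ?_, fun hu φ hφ => ?_⟩
  · have hclosed : IsClosed {w : W1p Ω p |
        fluxFunctional hσ (weakGradL Ω p u) (weakGradL Ω p w) = 0} :=
      isClosed_eq (by fun_prop) continuous_const
    refine closure_minimal ?_ hclosed hw
    rintro w ⟨φ, hφ, -, hgrad⟩
    exact (happly hgrad).trans (hu φ hφ)
  · obtain ⟨w, hw, hgrad⟩ := hφ.exists_mem_testSubmodule (p := p)
    exact (happly hgrad).symm.trans (hu w (subset_closure hw))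

theorem SolvesDirichlet.fluxFunctional_eq (hσ : MemLp σ ⊤ (volume.restrict Ω)) {F : TraceSpace Ω p}
    {u v w : W1p Ω p} (hu : SolvesDirichlet σ F u) (hvw : trace v = trace w) :
    fluxFunctional hσ (weakGradL Ω p u) (weakGradL Ω p v)
      = fluxFunctional hσ (weakGradL Ω p u) (weakGradL Ω p w) := by
  rw [← sub_eq_zero, ← map_sub, ← map_sub]
  exact (isWeakSolution_iff hσ).1 hu.1 _ (trace_eq_trace_iff.1 hvw)

theorem existsUnique_solvesDirichlet (hΩ : PoincareInequality Ω p) (hσ : σ ∈ LinftyPos Ω)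
    (F : TraceSpace Ω p) : ∃! u : W1p Ω p, SolvesDirichlet σ F u := by
  obtain ⟨f, rfl⟩ : ∃ f : W1p Ω p, trace f = F := Submodule.mkQ_surjective _ F
  obtain ⟨G, ⟨⟨w, hw, hwG⟩, hG⟩, hunique⟩ := existsUnique_fluxFunctional_eq_zero
    (σ := σ) hσ hΩ.isClosed_gradW1p0 (weakGradL Ω p f)
  have hgrad {u : W1p Ω p} (hu : SolvesDirichlet σ (trace f) u) : weakGradL Ω p u = G := by
    refine hunique _ ⟨⟨u - f, trace_eq_trace_iff.1 hu.2, map_sub _ _ _⟩, ?_⟩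
    rintro _ ⟨z, hz, rfl⟩
    exact (isWeakSolution_iff hσ.1).1 hu.1 z hz
  have hGw : weakGradL Ω p (f + w) = G := by
    rw [map_add, ← eq_sub_iff_add_eq']
    exact hwG
  have hsol : SolvesDirichlet σ (trace f) (f + w) := by
    refine ⟨(isWeakSolution_iff hσ.1).2 fun z hz => ?_, trace_eq_trace_iff.2 ?_⟩
    · rw [hGw]
      exact hG _ ⟨z, hz, rfl⟩
    · rwa [add_sub_cancel_left]
  exact ⟨f + w, hsol, fun u hu =>
    hΩ.eq_of_weakGradL_eq (hu.2.trans hsol.2.symm) ((hgrad hu).trans (hgrad hsol).symm)⟩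

theorem dnMap_trace (hΩ : PoincareInequality Ω p) (hσ : σ ∈ LinftyPos Ω) {F : TraceSpace Ω p}
    {u : W1p Ω p} (hu : SolvesDirichlet σ F u) (v : W1p Ω p) :
    dnMap σ F (trace v) = fluxFunctional hσ.1 (weakGradL Ω p u) (weakGradL Ω p v) := by
  have hex : ∃ ℓ, IsDNValue σ F ℓ :=
    ⟨(W1p0 Ω p).liftQL ((fluxFunctional hσ.1 (weakGradL Ω p u)).comp (weakGradL Ω p))
      ((isWeakSolution_iff hσ.1).1 hu.1), u, hu, fun v => fluxFunctional_apply hσ.1 _ _⟩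
  obtain ⟨u', hu', h⟩ := hex.choose_spec
  rw [(existsUnique_solvesDirichlet hΩ hσ F).unique hu' hu] at h
  rw [dnMap, dif_pos hex, h, fluxFunctional_apply]
  rfl

theorem dnMap_trace_self (hΩ : PoincareInequality Ω p) (hσ : σ ∈ LinftyPos Ω) {f u : W1p Ω p}
    (hu : SolvesDirichlet σ (trace f) u) :
    dnMap σ (trace f) (trace f) = energy σ (weakGradL Ω p u) := by
  rw [dnMap_trace hΩ hσ hu, hu.fluxFunctional_eq hσ.1 hu.2.symm, fluxFunctional_self]

theorem SolvesDirichlet.energy_le_energy (hσ : σ ∈ LinftyPos Ω) {F : TraceSpace Ω p}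
    {u v : W1p Ω p} (hu : SolvesDirichlet σ F u) (hv : trace v = F) :
    energy σ (weakGradL Ω p u) ≤ energy σ (weakGradL Ω p v) := by
  have h := mul_fluxFunctional_le_self (p := p) hσ (weakGradL Ω p u) (weakGradL Ω p v)
  rw [hu.fluxFunctional_eq hσ.1 (hv.trans hu.2.symm), fluxFunctional_self] at h
  linarith

theorem SolvesDirichlet.mul_energy_le_energy_sub (hσ₀ : σ₀ ∈ LinftyPos Ω) (hσ₁ : σ₁ ∈ LinftyPos Ω)
    {F : TraceSpace Ω p} {u v : W1p Ω p} (hu : SolvesDirichlet σ₀ F u) (hv : trace v = F) :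
    (p - 1) * energy (fun x => σ₀ x / σ₁ x ^ (1 / (p - 1))
        * (σ₁ x ^ (1 / (p - 1)) - σ₀ x ^ (1 / (p - 1)))) (weakGradL Ω p u)
      ≤ energy σ₁ (weakGradL Ω p v) - energy σ₀ (weakGradL Ω p u) := by
  have h := mul_fluxFunctional_le (p := p) hσ₀ hσ₁ (weakGradL Ω p u) (weakGradL Ω p v)
  rw [hu.fluxFunctional_eq hσ₀.1 (hv.trans hu.2.symm), fluxFunctional_self] at h
  rw [energy_div_rpow_mul_sub hσ₀ hσ₁]
  linarith

end Dirichlet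

end PCalderon

end

theorem lemma2p1_general {n : ℕ} {Ω : Set (PCalderon.E n)} {p : ℝ} [hp : Fact (1 < p)]
    (hΩ : PCalderon.PoincareInequality Ω p) :
    (∀ σ ∈ PCalderon.LinftyPos Ω, ∀ F : PCalderon.TraceSpace Ω p,
      ∃! u : PCalderon.W1p Ω p, PCalderon.SolvesDirichlet σ F u) ∧
    (∀ σ ∈ PCalderon.LinftyPos Ω, ∀ (F : PCalderon.TraceSpace Ω p) (u v : PCalderon.W1p Ω p),
      PCalderon.SolvesDirichlet σ F u →
        PCalderon.dnMap σ F (PCalderon.trace v)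
          = ∫ x in Ω, inner ℝ (PCalderon.flux σ u x) (PCalderon.weakGrad v x)) ∧
    (∀ σ₀ ∈ PCalderon.LinftyPos Ω, ∀ σ₁ ∈ PCalderon.LinftyPos Ω, ∀ f u₀ : PCalderon.W1p Ω p,
      PCalderon.SolvesDirichlet σ₀ (PCalderon.trace f) u₀ →
        (p - 1) * (∫ x in Ω, σ₀ x / σ₁ x ^ (1 / (p - 1))
              * (σ₁ x ^ (1 / (p - 1)) - σ₀ x ^ (1 / (p - 1))) * ‖PCalderon.weakGrad u₀ x‖ ^ p)
            ≤ (PCalderon.dnMap σ₁ (PCalderon.trace f) - PCalderon.dnMap σ₀ (PCalderon.trace f))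
                (PCalderon.trace f) ∧
        (PCalderon.dnMap σ₁ (PCalderon.trace f) - PCalderon.dnMap σ₀ (PCalderon.trace f))
                (PCalderon.trace f)
            ≤ ∫ x in Ω, (σ₁ x - σ₀ x) * ‖PCalderon.weakGrad u₀ x‖ ^ p) := by
  refine ⟨fun σ hσ F => PCalderon.existsUnique_solvesDirichlet hΩ hσ F, fun σ hσ F u v hu => ?_,
    fun σ₀ hσ₀ σ₁ hσ₁ f u₀ hu₀ => ?_⟩
  · rw [PCalderon.dnMap_trace hΩ hσ hu, PCalderon.fluxFunctional_apply]
    rfl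
  obtain ⟨u₁, hu₁, -⟩ := PCalderon.existsUnique_solvesDirichlet hΩ hσ₁ (PCalderon.trace f)
  rw [sub_apply, PCalderon.dnMap_trace_self hΩ hσ₀ hu₀, PCalderon.dnMap_trace_self hΩ hσ₁ hu₁]
  refine ⟨hu₀.mul_energy_le_energy_sub hσ₀ hσ₁ hu₁.2, ?_⟩
  calc PCalderon.energy σ₁ (PCalderon.weakGradL Ω p u₁)
        - PCalderon.energy σ₀ (PCalderon.weakGradL Ω p u₀)
      ≤ PCalderon.energy σ₁ (PCalderon.weakGradL Ω p u₀)
        - PCalderon.energy σ₀ (PCalderon.weakGradL Ω p u₀) :=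
        sub_le_sub_right (hu₁.energy_le_energy hσ₁ hu₀.2) _
    _ = ∫ x in Ω, (σ₁ x - σ₀ x) * ‖PCalderon.weakGrad u₀ x‖ ^ p :=
        (PCalderon.energy_sub hσ₁.1 hσ₀.1 _).symm

/-- Monotonicity inequality for the nonlinear Dirichlet-to-Neumann map. The first two parts say that
the Dirichlet problem is uniquely solvable and that the map `Λ_σ` is given by its weak formula,
the third part is the two-sided inequality. -/
theorem lemma2p1 {n : ℕ} (hn : 2 ≤ n) {Ω : Set (PCalderon.E n)} (hΩ : IsOpen Ω)
    (hΩb : Bornology.IsBounded Ω) {p : ℝ} [hp : Fact (1 < p)] :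
    (∀ σ ∈ PCalderon.LinftyPos Ω, ∀ F : PCalderon.TraceSpace Ω p,
      ∃! u : PCalderon.W1p Ω p, PCalderon.SolvesDirichlet σ F u) ∧
    (∀ σ ∈ PCalderon.LinftyPos Ω, ∀ (F : PCalderon.TraceSpace Ω p) (u v : PCalderon.W1p Ω p),
      PCalderon.SolvesDirichlet σ F u →
        PCalderon.dnMap σ F (PCalderon.trace v)
          = ∫ x in Ω, inner ℝ (PCalderon.flux σ u x) (PCalderon.weakGrad v x)) ∧
    (∀ σ₀ ∈ PCalderon.LinftyPos Ω, ∀ σ₁ ∈ PCalderon.LinftyPos Ω, ∀ f u₀ : PCalderon.W1p Ω p,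
      PCalderon.SolvesDirichlet σ₀ (PCalderon.trace f) u₀ →
        (p - 1) * (∫ x in Ω, σ₀ x / σ₁ x ^ (1 / (p - 1))
              * (σ₁ x ^ (1 / (p - 1)) - σ₀ x ^ (1 / (p - 1))) * ‖PCalderon.weakGrad u₀ x‖ ^ p)
            ≤ (PCalderon.dnMap σ₁ (PCalderon.trace f) - PCalderon.dnMap σ₀ (PCalderon.trace f))
                (PCalderon.trace f) ∧
        (PCalderon.dnMap σ₁ (PCalderon.trace f) - PCalderon.dnMap σ₀ (PCalderon.trace f))
                (PCalderon.trace f)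
            ≤ ∫ x in Ω, (σ₁ x - σ₀ x) * ‖PCalderon.weakGrad u₀ x‖ ^ p) :=
  lemma2p1_general (PCalderon.poincareInequality_of_isBounded (by omega) hΩb)
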